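/- For every integer $k \ge 1$ let $f_k : [\frac{1}{k+1}, \frac1k] \to [0,1]$ be the decreasing affine function with $f_k(\frac{1}{k+1}) = 1$ and $f_k(\frac1k) = 0$, and let $g_k = f_k^{-1} : [0,1] \to [\frac{1}{k+1}, \frac1k]$. For $n \ge 1$ let $$J_n = \bigcap_{l=1}^{\infty} \; \bigcup_{(q_1, \dots, q_l) \in \{1, \dots, n\}^l} g_{q_1} \circ g_{q_2} \circ \dots \circ g_{q_l}([0,1])$$ be the limit set of the iterated function system $\{g_1, \dots, g_n\}$. For $E \subset \mathbb{R}$ and $\delta > 0$, a $\delta$-packing of $E$ is a countable family of pairwise disjoint closed balls with centers in $E$ and positive radii at most $\delta$. For $s \ge 0$ put $$P_s(E) = \inf_{\delta > 0} \; \sup \Big\{ \sum_{B \in \mathcal{R}} (\operatorname{diam} B)^s : \mathcal{R} \text{ is a } \delta\text{-packing of } E \Big\}, \qquad \mathcal{P}_s(E) = \inf \Big\{ \sum_{i=1}^{\infty} P_s(E_i) : E \subset \bigcup_{i=1}^{\infty} E_i \Big\};$$ $\mathcal{P}_s$ is the $s$-dimensional packing measure. Let $h_n = \inf\{ s \ge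 0 : \mathcal{P}_s(J_n) = 0 \}$ be the packing dimension of $J_n$. Theorem. $$\liminf_{n \to \infty} \mathcal{P}_{h_n}(J_n) \ge 2.$$ -/

import Mathlib

open Set Filter

noncomputable section

namespace LinearGauss

/-! Packing measures and packing dimension of subsets of the real line. -/

/-- `R` is (the set of pairs `(x, r)` of centres and radii of) a `δ`-packing of `E`: a countable
family of pairwise disjoint closed balls `B(x, r)` with centres `x ∈ E` and radii `0 < r ≤ δ`.
A closed ball of positive radius in `ℝ` determines its centre and radius. -/
structure IsPacking (δ : ℝ) (E : Set ℝ) (R : Set (ℝ × ℝ)) : Prop where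
  countable : R.Countable
  center_mem : ∀ p ∈ R, p.1 ∈ E
  radius_pos : ∀ p ∈ R, 0 < p.2
  radius_le : ∀ p ∈ R, p.2 ≤ δ
  disjoint : R.PairwiseDisjoint fun p => Metric.closedBall p.1 p.2

/-- The supremum over all `δ`-packings of `E` of the sum of the `s`-th powers of the diameters. -/
def packingSup (s δ : ℝ) (E : Set ℝ) : ENNReal :=
  ⨆ (R : Set (ℝ × ℝ)) (_ : IsPacking δ E R),
    ∑' p : R, ENNReal.ofReal (Metric.diam (Metric.closedBall p.1.1 p.1.2)) ^ s

/-- The `s`-dimensional packing premeasure. -/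
def packingPremeasure (s : ℝ) (E : Set ℝ) : ENNReal :=
  ⨅ (δ : ℝ) (_ : 0 < δ), packingSup s δ E

/-- The `s`-dimensional packing measure (for `s ≥ 0`). -/
def packingMeasure (s : ℝ) (E : Set ℝ) : ENNReal :=
  ⨅ (A : ℕ → Set ℝ) (_ : E ⊆ ⋃ i, A i), ∑' i, packingPremeasure s (A i)

/-- The packing dimension of a subset of the line. The set on the right is never empty:
it contains every `s > 1`. -/
def packingDim (E : Set ℝ) : ℝ :=
  sInf {s : ℝ | 0 ≤ s ∧ packingMeasure s E = 0}

/-! The linear analogue of the Gauss map and its limit sets. -/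

/-- For `k ≥ 1`, on `[1/(k+1), 1/k]`, the affine function with value `1` at `1/(k+1)` and
`0` at `1/k`. -/
def f (k : ℕ) (x : ℝ) : ℝ := k * (k + 1) * (1 / k - x)

/-- The inverse of `f k`. -/
def g (k : ℕ) (y : ℝ) : ℝ := 1 / k - (1 / k - 1 / (k + 1)) * y

theorem f_left {k : ℕ} (hk : 1 ≤ k) : f k (1 / (k + 1)) = 1 := by
  have : (k : ℝ) ≠ 0 := by positivity
  unfold f; field_simp; ring

theorem f_right (k : ℕ) : f k (1 / k) = 0 := by simp [f]

theorem f_strictAnti {k : ℕ} (hk : 1 ≤ k) : StrictAnti (f k) := by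
  intro x y hxy
  have : (0 : ℝ) < k * (k + 1) := by positivity
  unfold f
  exact mul_lt_mul_of_pos_left (by linarith) this

theorem g_f {k : ℕ} (hk : 1 ≤ k) (x : ℝ) : g k (f k x) = x := by
  have : (k : ℝ) ≠ 0 := by positivity
  unfold f g; field_simp; ring

theorem f_g {k : ℕ} (hk : 1 ≤ k) (y : ℝ) : f k (g k y) = y := by
  have : (k : ℝ) ≠ 0 := by positivity
  unfold f g; field_simp; ring

/-- The composition `g q₁ ∘ g q₂ ∘ ⋯ ∘ g q_l` for the word `q = [q₁, …, q_l]`. -/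
def wordMap : List ℕ → ℝ → ℝ
  | [] => id
  | k :: q => g k ∘ wordMap q

/-- The limit set `J n` of the system `g 1, …, g n`: the intersection over `l ≥ 1` of the unions of
the images of `[0, 1]` under all words of length `l` in the letters `1, …, n`. -/
def J (n : ℕ) : Set ℝ :=
  ⋂ (l : ℕ) (_ : 1 ≤ l), ⋃ (q : List ℕ) (_ : q.length = l ∧ ∀ k ∈ q, 1 ≤ k ∧ k ≤ n),
    wordMap q '' Icc 0 1

/-- The packing dimension `h n` of `J n`. -/
def h (n : ℕ) : ℝ := packingDim (J n)

end LinearGauss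

end

namespace LinearGauss

open MeasureTheory Topology

/-! Let `s ≤ 1` solve `∑ ratio k ^ s = 1` over the `n` letters. The Bernoulli measure with weights
`ratio k ^ s`, pushed to the line by `coding`, is a probability measure giving a cylinder of length
`L` mass at least `L ^ s`. Almost every code uses the last letter infinitely often. At such a time,
rescale the current cylinder to `[0, 1]`: the point lies in `[1/(n+1), 1/n]`, and the ball of radius
`1/(n+1)` about it lies in `[0, 2/n]`. About half of that ball is the empty gap `[0, 1/(n+1))`, so
its mass is about `2/n - 1/n = 1/n` against a diameter of about `2/n` (`limitMeasure_closedBall_le`,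
`letterMeasure_tail_le`).

Thus almost every point has arbitrarily small balls of density at most `densityBound n`, which tends
to `1/2`. A Besicovitch covering turns this into packing measure at least `1 / densityBound n` in
exponent `s` (`measure_le_packingMeasure`). Since `1 - s = O(1/n)`, replacing `ratio k ^ s` by
`ratio k` costs a factor tending to `1`.

The equality `h n = s` is not needed: `h n ≤ s` (`h_le`) suffices, because packing measures decrease
with the exponent. -/

/-! ### Packing measures and densities of finite measures. -/

theorem packingPremeasure_mono {s : ℝ} {E F : Set ℝ} (hEF : E ⊆ F) :
    packingPremeasure s E ≤ packingPremeasure s F := by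
  refine iInf₂_mono fun δ _ => iSup₂_le fun R hR => ?_
  exact le_iSup₂_of_le R ⟨hR.countable, fun p hp => hEF (hR.center_mem p hp), hR.radius_pos,
    hR.radius_le, hR.disjoint⟩ le_rfl

theorem packingMeasure_le_packingPremeasure_of_eq_zero {s : ℝ} {E : Set ℝ}
    (hE : packingPremeasure s E = 0) : packingMeasure s E = 0 := by
  refine le_antisymm ?_ bot_le
  refine iInf₂_le_of_le (fun _ => E) (subset_iUnion (fun _ : ℕ => E) 0) ?_
  simp [hE]

/-- Packing measures decrease with the exponent. -/
theorem packingMeasure_anti (E : Set ℝ) : Antitone fun s => packingMeasure s E := by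
  intro s t hst
  refine iInf₂_mono fun A _ => ENNReal.tsum_le_tsum fun i => ?_
  refine le_iInf₂ fun δ hδ => ?_
  -- Radii at most `1/2` keep diameters at most `1`, where powers decrease in the exponent.
  refine iInf₂_le_of_le (min δ (1 / 2)) (by positivity) ?_
  refine iSup₂_le fun R hR => ?_
  refine le_iSup₂_of_le R ⟨hR.countable, hR.center_mem, hR.radius_pos,
    fun p hp => (hR.radius_le p hp).trans (min_le_left _ _), hR.disjoint⟩ ?_
  refine ENNReal.tsum_le_tsum fun p => ?_
  refine ENNReal.rpow_le_rpow_of_exponent_ge ?_ hst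
  have h1 := (hR.radius_le p p.2).trans (min_le_right _ _)
  rw [Metric.diam_closedBall_eq _ (hR.radius_pos p p.2).le, ← ENNReal.ofReal_one]
  exact ENNReal.ofReal_le_ofReal (by linarith)

/-- A lower bound for the packing premeasure from an upper bound for the measure of small balls. -/
theorem measure_le_packingPremeasure (μ : Measure ℝ) [IsFiniteMeasure μ] {s : ℝ} {C : ENNReal}
    (hC0 : C ≠ 0) (hC : C ≠ ⊤) {G : Set ℝ}
    (hG : ∀ x ∈ G, ∀ δ > 0, ∃ r, 0 < r ∧ r < δ ∧
      μ (Metric.closedBall x r) ≤ C * ENNReal.ofReal (2 * r) ^ s) :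
    μ G ≤ C * packingPremeasure s G := by
  have key : ∀ δ > 0, μ G ≤ C * packingSup s δ G := by
    intro δ hδ
    -- The good radii form a fine cover, so disjoint good balls of radius below `δ` exhaust `G` up
    -- to a `μ`-null set; they form a packing.
    obtain ⟨t, r, htc, htG, hr, hcov, hdisj⟩ := Besicovitch.exists_disjoint_closedBall_covering_ae μ
      (fun x => {r | μ (Metric.closedBall x r) ≤ C * ENNReal.ofReal (2 * r) ^ s}) G
      (fun x hx ε hε => by
        obtain ⟨r, h0, h1, h2⟩ := hG x hx ε hε
        exact ⟨r, h2, h0, h1⟩) (fun _ => δ) (fun _ _ => hδ)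
    have hinj : Function.Injective fun x => (x, r x) := fun x y hxy => congrArg Prod.fst hxy
    have hpack : IsPacking δ G ((fun x => (x, r x)) '' t) := by
      refine ⟨htc.image _, ?_, ?_, ?_, ?_⟩
      · rintro _ ⟨x, hx, rfl⟩; exact htG hx
      · rintro _ ⟨x, hx, rfl⟩; exact (hr x hx).2.1
      · rintro _ ⟨x, hx, rfl⟩; exact (hr x hx).2.2.le
      · rintro _ ⟨x, hx, rfl⟩ _ ⟨y, hy, rfl⟩ hxy
        exact hdisj hx hy (fun e => hxy (by rw [e]))
    calc μ G ≤ μ (G \ ⋃ x ∈ t, Metric.closedBall x (r x))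
          + μ (⋃ x ∈ t, Metric.closedBall x (r x)) := by
          refine (measure_mono ?_).trans (measure_union_le _ _)
          rw [sdiff_union_self]; exact subset_union_left
      _ ≤ ∑' x : t, μ (Metric.closedBall x.1 (r x)) := by
          rw [hcov, zero_add]; exact measure_biUnion_le μ htc _
      _ ≤ ∑' x : t, C * ENNReal.ofReal (Metric.diam (Metric.closedBall x.1 (r x))) ^ s := by
          refine ENNReal.tsum_le_tsum fun x => ?_
          rw [Metric.diam_closedBall_eq _ (hr x x.2).2.1.le]
          exact (hr x x.2).1
      _ = C * ∑' p : (fun x => (x, r x)) '' t,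
            ENNReal.ofReal (Metric.diam (Metric.closedBall p.1.1 p.1.2)) ^ s := by
          rw [ENNReal.tsum_mul_left, tsum_image (fun p : ℝ × ℝ =>
            ENNReal.ofReal (Metric.diam (Metric.closedBall p.1 p.2)) ^ s) hinj.injOn]
      _ ≤ C * packingSup s δ G := by
          gcongr
          exact le_iSup₂_of_le _ hpack le_rfl
  rw [← ENNReal.div_le_iff' hC0 hC]
  refine le_iInf₂ fun δ hδ => ?_
  rw [ENNReal.div_le_iff' hC0 hC]
  exact key δ hδ

/-- A lower bound for the packing measure from an upper bound for the measure of small balls. -/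
theorem measure_le_packingMeasure (μ : Measure ℝ) [IsFiniteMeasure μ] {s : ℝ} {C : ENNReal}
    (hC0 : C ≠ 0) (hC : C ≠ ⊤) {G E : Set ℝ} (hGE : G ⊆ E)
    (hG : ∀ x ∈ G, ∀ δ > 0, ∃ r, 0 < r ∧ r < δ ∧
      μ (Metric.closedBall x r) ≤ C * ENNReal.ofReal (2 * r) ^ s) :
    μ G ≤ C * packingMeasure s E := by
  rw [← ENNReal.div_le_iff' hC0 hC]
  refine le_iInf₂ fun A hA => ?_
  rw [ENNReal.div_le_iff' hC0 hC]
  calc μ G ≤ μ (⋃ i, A i ∩ G) := by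
        refine measure_mono fun x hx => ?_
        obtain ⟨i, hi⟩ := mem_iUnion.1 (hA (hGE hx))
        exact mem_iUnion.2 ⟨i, hi, hx⟩
    _ ≤ ∑' i, μ (A i ∩ G) := measure_iUnion_le _
    _ ≤ ∑' i, C * packingPremeasure s (A i) := by
        refine ENNReal.tsum_le_tsum fun i => ?_
        refine (measure_le_packingPremeasure μ hC0 hC fun x hx => hG x hx.2).trans ?_
        gcongr
        exact packingPremeasure_mono inter_subset_left
    _ = C * ∑' i, packingPremeasure s (A i) := ENNReal.tsum_mul_left

/-- A set which carries a finite measure whose small balls have mass at least a multiple of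
`r ^ s` has zero packing measure in every exponent above `s`. -/
theorem packingMeasure_eq_zero (μ : Measure ℝ) [IsFiniteMeasure μ] {s t r₀ : ℝ} {c : ENNReal}
    (hc : c ≠ 0) (hct : c ≠ ⊤) (hst : s < t) (hr₀ : 0 < r₀) {E : Set ℝ}
    (hE : ∀ x ∈ E, ∀ r, 0 < r → r ≤ r₀ →
      c * ENNReal.ofReal (2 * r) ^ s ≤ μ (Metric.closedBall x r)) :
    packingMeasure t E = 0 := by
  apply packingMeasure_le_packingPremeasure_of_eq_zero
  have hts : 0 < t - s := sub_pos.2 hst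
  have key : ∀ δ, 0 < δ → δ ≤ r₀ →
      packingPremeasure t E ≤ ENNReal.ofReal (2 * δ) ^ (t - s) * (μ univ / c) := by
    intro δ hδ hδr
    refine iInf₂_le_of_le δ hδ (iSup₂_le fun R hR => ?_)
    have hsum : ∑' p : R, ENNReal.ofReal (2 * p.1.2) ^ s ≤ μ univ / c := by
      rw [ENNReal.le_div_iff_mul_le (.inl hc) (.inl hct), mul_comm, ← ENNReal.tsum_mul_left]
      calc ∑' p : R, c * ENNReal.ofReal (2 * p.1.2) ^ s
          ≤ ∑' p : R, μ (Metric.closedBall p.1.1 p.1.2) :=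
            ENNReal.tsum_le_tsum fun p => hE _ (hR.center_mem p p.2) _ (hR.radius_pos p p.2)
              ((hR.radius_le p p.2).trans hδr)
        _ = μ (⋃ p ∈ R, Metric.closedBall p.1 p.2) :=
            (measure_biUnion hR.countable hR.disjoint
              fun _ _ => Metric.isClosed_closedBall.measurableSet).symm
        _ ≤ μ univ := measure_mono (subset_univ _)
    calc ∑' p : R, ENNReal.ofReal (Metric.diam (Metric.closedBall p.1.1 p.1.2)) ^ t
        ≤ ∑' p : R, ENNReal.ofReal (2 * δ) ^ (t - s) * ENNReal.ofReal (2 * p.1.2) ^ s := by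
          refine ENNReal.tsum_le_tsum fun p => ?_
          have hp := hR.radius_pos p p.2
          rw [Metric.diam_closedBall_eq _ hp.le]
          have h1 : ENNReal.ofReal (2 * p.1.2) ^ t
              = ENNReal.ofReal (2 * p.1.2) ^ (t - s) * ENNReal.ofReal (2 * p.1.2) ^ s := by
            rw [← ENNReal.rpow_add _ _ (by simpa using hp) ENNReal.ofReal_ne_top, sub_add_cancel]
          rw [h1]
          gcongr
          exact hR.radius_le p p.2
      _ = ENNReal.ofReal (2 * δ) ^ (t - s) * ∑' p : R, ENNReal.ofReal (2 * p.1.2) ^ s :=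
          ENNReal.tsum_mul_left
      _ ≤ _ := by gcongr
  have hK : μ univ / c ≠ ⊤ := ENNReal.div_ne_top (measure_ne_top _ _) hc
  have hlim : Tendsto (fun δ : ℝ => ENNReal.ofReal (2 * δ) ^ (t - s) * (μ univ / c)) (𝓝[>] 0)
      (𝓝 0) := by
    have h1 : Tendsto (fun δ : ℝ => ENNReal.ofReal (2 * δ) ^ (t - s)) (𝓝 0) (𝓝 0) := by
      have h2 : Continuous fun δ : ℝ => ENNReal.ofReal (2 * δ) ^ (t - s) :=
      ENNReal.continuous_rpow_const.comp (ENNReal.continuous_ofReal.comp (by fun_prop))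
      have h3 := h2.tendsto 0
      rwa [mul_zero, ENNReal.ofReal_zero, ENNReal.zero_rpow_of_pos hts] at h3
    have h4 := ENNReal.Tendsto.mul_const (b := μ univ / c) 
      (h1.mono_left (nhdsWithin_le_nhds (s := Ioi 0)))
      (.inr hK)
    rwa [zero_mul] at h4
  refine le_antisymm (ge_of_tendsto hlim ?_) bot_le
  filter_upwards [Ioc_mem_nhdsGT hr₀] with δ hδ using key δ hδ.1 hδ.2

/-! Coding of the limit sets: the letter `k : ℕ` stands for the map `g (k + 1)`. -/

/-- The contraction ratio of `g (k + 1)`. -/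
noncomputable def ratio (k : ℕ) : ℝ := 1 / ((k + 1) * (k + 2))

theorem ratio_pos (k : ℕ) : 0 < ratio k := by unfold ratio; positivity

theorem ratio_eq_sub (k : ℕ) : ratio k = 1 / (k + 1) - 1 / (k + 2) := by
  unfold ratio; field_simp; ring

theorem ratio_anti : Antitone ratio := by
  intro k l hkl
  have : (k : ℝ) ≤ l := by exact_mod_cast hkl
  unfold ratio
  gcongr

theorem ratio_le_half (k : ℕ) : ratio k ≤ 1 / 2 := by
  refine (ratio_anti (Nat.zero_le k)).trans ?_
  norm_num [ratio]

theorem g_succ (k : ℕ) (y : ℝ) : g (k + 1) y = 1 / (k + 1) - ratio k * y := by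
  unfold g; rw [ratio_eq_sub]; push_cast; ring

theorem g_succ_mem (k : ℕ) {y : ℝ} (hy : y ∈ Icc (0 : ℝ) 1) :
    g (k + 1) y ∈ Icc (1 / ((k : ℝ) + 2)) (1 / (k + 1)) := by
  have h0 := ratio_pos k
  have h1 := ratio_eq_sub k
  rw [g_succ]
  constructor <;> nlinarith [hy.1, hy.2]

theorem g_succ_mem_Ioo (k : ℕ) {y : ℝ} (hy : y ∈ Ioo (0 : ℝ) 1) :
    g (k + 1) y ∈ Ioo (1 / ((k : ℝ) + 2)) (1 / (k + 1)) := by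
  have h0 := ratio_pos k
  have h1 := ratio_eq_sub k
  rw [g_succ]
  constructor <;> nlinarith [hy.1, hy.2]

theorem one_div_Icc_subset (k : ℕ) : Icc (1 / ((k : ℝ) + 2)) (1 / (k + 1)) ⊆ Icc 0 1 := by
  refine Icc_subset_Icc (by positivity) ?_
  rw [div_le_one (by positivity)]
  linarith [(Nat.cast_nonneg k : (0 : ℝ) ≤ k)]

/-- The composition of the maps of the first `l` letters of `ω`. -/
noncomputable def prefixMap : ℕ → (ℕ → ℕ) → ℝ → ℝ
  | 0, _, y => y
  | l + 1, ω, y => g (ω 0 + 1) (prefixMap l (fun i => ω (i + 1)) y)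

/-- The contraction ratio of `prefixMap l ω`. -/
noncomputable def prefixRatio (l : ℕ) (ω : ℕ → ℕ) : ℝ := ∏ i ∈ Finset.range l, ratio (ω i)

theorem prefixRatio_pos (l : ℕ) (ω : ℕ → ℕ) : 0 < prefixRatio l ω :=
  Finset.prod_pos fun _ _ => ratio_pos _

theorem prefixRatio_le (l : ℕ) (ω : ℕ → ℕ) : prefixRatio l ω ≤ (1 / 2) ^ l := by
  calc prefixRatio l ω ≤ ∏ _i ∈ Finset.range l, (1 / 2 : ℝ) :=
        Finset.prod_le_prod (fun _ _ => (ratio_pos _).le) fun _ _ => ratio_le_half _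
    _ = _ := by simp

theorem prefixMap_sub (l : ℕ) (ω : ℕ → ℕ) (y z : ℝ) :
    prefixMap l ω y - prefixMap l ω z = (-1) ^ l * prefixRatio l ω * (y - z) := by
  induction l generalizing ω with
  | zero => simp [prefixMap, prefixRatio]
  | succ l ih =>
    have h1 : prefixRatio (l + 1) ω = prefixRatio l (fun i => ω (i + 1)) * ratio (ω 0) :=
      Finset.prod_range_succ' _ _
    simp only [prefixMap, g_succ, h1]
    linear_combination (- ratio (ω 0)) * ih (fun i => ω (i + 1))

theorem abs_prefixMap_sub (l : ℕ) (ω : ℕ → ℕ) (y z : ℝ) :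
    |prefixMap l ω y - prefixMap l ω z| = prefixRatio l ω * |y - z| := by
  rw [prefixMap_sub, abs_mul, abs_mul, abs_pow, abs_neg, abs_one, one_pow, one_mul,
    abs_of_pos (prefixRatio_pos l ω)]

theorem prefixMap_injective (l : ℕ) (ω : ℕ → ℕ) : Function.Injective (prefixMap l ω) := by
  intro y z hyz
  have h1 := abs_prefixMap_sub l ω y z
  rw [hyz, sub_self, abs_zero, eq_comm, mul_eq_zero, or_iff_right (prefixRatio_pos l ω).ne',
    abs_eq_zero] at h1
  linarith

theorem prefixMap_mem_Icc (l : ℕ) (ω : ℕ → ℕ) {y : ℝ} (hy : y ∈ Icc (0 : ℝ) 1) :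
    prefixMap l ω y ∈ Icc (0 : ℝ) 1 := by
  induction l generalizing ω with
  | zero => exact hy
  | succ l ih => exact one_div_Icc_subset _ (g_succ_mem _ (ih _))

theorem prefixMap_add (j l : ℕ) (ω : ℕ → ℕ) (y : ℝ) :
    prefixMap (j + l) ω y = prefixMap j ω (prefixMap l (fun i => ω (i + j)) y) := by
  induction j generalizing ω with
  | zero => simp [prefixMap]
  | succ j ih =>
    rw [Nat.add_right_comm]
    simp only [prefixMap, ih]
    rfl

/-- The point of `[0, 1]` with the code `ω`. -/
noncomputable def coding (ω : ℕ → ℕ) : ℝ := limUnder atTop fun l => prefixMap l ω 0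

theorem tendsto_coding (ω : ℕ → ℕ) :
    Tendsto (fun l => prefixMap l ω 0) atTop (𝓝 (coding ω)) := by
  refine CauchySeq.tendsto_limUnder (cauchySeq_of_le_geometric (1 / 2) 1 (by norm_num) fun l => ?_)
  have h1 := prefixMap_mem_Icc 1 (fun i => ω (i + l)) (left_mem_Icc.2 zero_le_one)
  rw [Real.dist_eq, prefixMap_add l 1, abs_prefixMap_sub, one_mul, zero_sub, abs_neg,
    abs_of_nonneg h1.1]
  exact (mul_le_of_le_one_right (prefixRatio_pos _ _).le h1.2).trans (prefixRatio_le l ω)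

theorem continuous_g (k : ℕ) : Continuous (g k) := by unfold g; fun_prop

theorem coding_eq_g (ω : ℕ → ℕ) : coding ω = g (ω 0 + 1) (coding fun i => ω (i + 1)) :=
  tendsto_nhds_unique ((tendsto_add_atTop_iff_nat 1).2 (tendsto_coding ω))
    (((continuous_g _).tendsto _).comp (tendsto_coding fun i => ω (i + 1)))

theorem coding_eq_prefixMap (l : ℕ) (ω : ℕ → ℕ) :
    coding ω = prefixMap l ω (coding fun i => ω (i + l)) := by
  induction l generalizing ω with
  | zero => rfl
  | succ l ih =>
    rw [coding_eq_g, ih]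
    simp only [prefixMap]
    rfl

theorem coding_mem_Icc (ω : ℕ → ℕ) : coding ω ∈ Icc (0 : ℝ) 1 :=
  isClosed_Icc.mem_of_tendsto (tendsto_coding ω)
    (Eventually.of_forall fun l => prefixMap_mem_Icc l ω (left_mem_Icc.2 zero_le_one))

theorem coding_mem_first (ω : ℕ → ℕ) :
    coding ω ∈ Icc (1 / ((ω 0 : ℝ) + 2)) (1 / (ω 0 + 1)) := by
  rw [coding_eq_g]; exact g_succ_mem _ (coding_mem_Icc _)

theorem coding_pos (ω : ℕ → ℕ) : 0 < coding ω :=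
  lt_of_lt_of_le (by positivity) (coding_mem_first ω).1

/-- Strictness matters because neighbouring closed cylinders share endpoints: infinite codes never
land there, so their cylinders are unambiguous. -/
theorem coding_mem_Ioo (ω : ℕ → ℕ) : coding ω ∈ Ioo (0 : ℝ) 1 := by
  refine ⟨coding_pos ω, ?_⟩
  rw [coding_eq_g, g_succ]
  have h1 := mul_pos (ratio_pos (ω 0)) (coding_pos fun i => ω (i + 1))
  have h2 := (one_div_Icc_subset (ω 0) (right_mem_Icc.2 (by gcongr; norm_num))).2
  linarith

/-- A point of the form `coding ω` lies in a cylinder interval only if `ω` has its prefix. -/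
theorem eq_of_coding_eq_prefixMap (l : ℕ) (ω η : ℕ → ℕ) {z : ℝ} (hz : z ∈ Icc (0 : ℝ) 1)
    (h : coding ω = prefixMap l η z) : ∀ i < l, ω i = η i := by
  induction l generalizing ω η with
  | zero => simp
  | succ l ih =>
    have h1 : coding ω ∈ Ioo (1 / ((ω 0 : ℝ) + 2)) (1 / (ω 0 + 1)) := by
      rw [coding_eq_g]; exact g_succ_mem_Ioo _ (coding_mem_Ioo _)
    have h2 : coding ω ∈ Icc (1 / ((η 0 : ℝ) + 2)) (1 / (η 0 + 1)) := by
      rw [h]; exact g_succ_mem _ (prefixMap_mem_Icc _ _ hz)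
    have h3 : ω 0 = η 0 := by
      have h4 := h2.1.trans_lt h1.2
      have h5 := h1.1.trans_le h2.2
      rw [one_div_lt_one_div (by positivity) (by positivity)] at h4 h5
      have h6 : ω 0 + 1 < η 0 + 2 := by exact_mod_cast h4
      have h7 : η 0 + 1 < ω 0 + 2 := by exact_mod_cast h5
      omega
    intro i hi
    cases i with
    | zero => exact h3
    | succ i =>
      refine ih (fun i => ω (i + 1)) (fun i => η (i + 1)) ?_ i (by omega)
      rw [coding_eq_g, h3] at h
      have h8 : g (η 0 + 1) (coding fun i => ω (i + 1))
          = g (η 0 + 1) (prefixMap l (fun i => η (i + 1)) z) := h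
      rw [← f_g (Nat.le_add_left 1 (η 0)) (coding _), h8, f_g (Nat.le_add_left 1 (η 0))]

theorem measurable_prefixMap (l : ℕ) (y : ℝ) : Measurable fun ω : ℕ → ℕ => prefixMap l ω y := by
  induction l with
  | zero => exact measurable_const
  | succ l ih =>
    have h1 : Measurable fun ω : ℕ → ℕ => prefixMap l (fun i => ω (i + 1)) y :=
      ih.comp (measurable_pi_lambda _ fun i => measurable_pi_apply (i + 1))
    have h2 : Measurable fun ω : ℕ → ℕ => (1 : ℝ) / ((ω 0 : ℕ) + 1) :=
      (Measurable.of_discrete (f := fun k : ℕ => (1 : ℝ) / (k + 1))).comp (measurable_pi_apply 0)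
    have h3 : Measurable fun ω : ℕ → ℕ => ratio (ω 0) :=
      (Measurable.of_discrete (f := ratio)).comp (measurable_pi_apply 0)
    simp only [prefixMap, g_succ]
    exact h2.sub (h3.mul h1)

theorem measurable_coding : Measurable coding :=
  measurable_of_tendsto_metrizable (fun l => measurable_prefixMap l 0)
    (tendsto_pi_nhds.2 tendsto_coding)

theorem wordMap_map_range (l : ℕ) (ω : ℕ → ℕ) :
    wordMap ((List.range l).map fun i => ω i + 1) = prefixMap l ω := by
  induction l generalizing ω with
  | zero => rfl
  | succ l ih =>
    funext y
    have h1 := congrFun (ih fun i => ω (i + 1)) y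
    simp only [List.range_succ_eq_map, List.map_cons, List.map_map, wordMap, prefixMap,
      Function.comp_apply, ← h1]
    rfl

theorem coding_mem_J {n : ℕ} {ω : ℕ → ℕ} (hω : ∀ i, ω i < n) : coding ω ∈ J n := by
  refine mem_iInter₂.2 fun l _ => mem_iUnion₂.2 ⟨(List.range l).map fun i => ω i + 1, ⟨?_, ?_⟩, ?_⟩
  · simp
  · intro k hk
    obtain ⟨i, -, rfl⟩ := List.mem_map.1 hk
    exact ⟨by omega, hω i⟩
  · rw [wordMap_map_range, coding_eq_prefixMap l]
    exact mem_image_of_mem _ (coding_mem_Icc _)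

theorem exists_prefixMap_eq_wordMap {n : ℕ} (q : List ℕ) (hq : ∀ k ∈ q, 1 ≤ k ∧ k ≤ n) :
    ∃ η : ℕ → ℕ, (∀ i < q.length, η i < n) ∧ wordMap q = prefixMap q.length η := by
  -- Letters shift down by one; the default value is never used by the prefix.
  refine ⟨fun i => q.getD i 1 - 1, fun i hi => ?_, ?_⟩
  · have h1 := hq _ (List.getElem_mem hi)
    simp only [List.getD_eq_getElem _ _ hi]
    omega
  · induction q with
    | nil => rfl
    | cons k q ih =>
      funext y
      have h1 := congrFun (ih fun k hk => hq k (List.mem_cons_of_mem _ hk)) y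
      have h2 := (hq k List.mem_cons_self).1
      simp only [wordMap, Function.comp_apply, h1, List.length_cons, prefixMap,
        List.getD_cons_zero, List.getD_cons_succ, Nat.sub_add_cancel h2]

theorem exists_prefixMap_of_mem_J {n : ℕ} {x : ℝ} (hx : x ∈ J n) {l : ℕ} (hl : 1 ≤ l) :
    ∃ η : ℕ → ℕ, (∀ i < l, η i < n) ∧ x ∈ prefixMap l η '' Icc 0 1 := by
  obtain ⟨q, ⟨rfl, hq⟩, hxq⟩ := mem_iUnion₂.1 (mem_iInter₂.1 hx l hl)
  obtain ⟨η, hη, hw⟩ := exists_prefixMap_eq_wordMap q hq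
  exact ⟨η, hη, hw ▸ hxq⟩

/-! The self-similar measure. -/

/-- The measure on the letters with weights `ratio k ^ s` for `k < n`. -/
noncomputable def letterMeasure (n : ℕ) (s : ℝ) : Measure ℕ :=
  ∑ k ∈ Finset.range n, ENNReal.ofReal (ratio k ^ s) • Measure.dirac k

theorem letterMeasure_apply (n : ℕ) (s : ℝ) (t : Set ℕ) [DecidablePred (· ∈ t)] :
    letterMeasure n s t = ∑ k ∈ Finset.range n with k ∈ t, ENNReal.ofReal (ratio k ^ s) := by
  classical
  simp [letterMeasure, Finset.sum_filter, Set.indicator_apply]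

theorem letterMeasure_singleton {n k : ℕ} (hk : k < n) (s : ℝ) :
    letterMeasure n s {k} = ENNReal.ofReal (ratio k ^ s) := by
  classical
  rw [letterMeasure_apply]
  refine (Finset.sum_congr ?_ fun _ _ => rfl).trans (Finset.sum_singleton _ k)
  ext i
  simp only [Finset.mem_filter, Finset.mem_range, mem_singleton_iff, Finset.mem_singleton]
  exact ⟨fun h => h.2, fun h => ⟨h ▸ hk, h⟩⟩

theorem isProbabilityMeasure_letterMeasure {n : ℕ} {s : ℝ}
    (hs : ∑ k ∈ Finset.range n, ratio k ^ s = 1) : IsProbabilityMeasure (letterMeasure n s) := by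
  classical
  constructor
  rw [letterMeasure_apply, ← ENNReal.ofReal_sum_of_nonneg
    fun k _ => Real.rpow_nonneg (ratio_pos k).le s]
  simp [hs]

/-- The Bernoulli measure on codes with a given distribution of the letters. -/
noncomputable abbrev codeMeasure (ν : Measure ℕ) [IsProbabilityMeasure ν] : Measure (ℕ → ℕ) :=
  Measure.infinitePi fun _ => ν

section

variable (ν : Measure ℕ) [IsProbabilityMeasure ν]

theorem codeMeasure_pi (u : Finset ℕ) (t : ℕ → Set ℕ) :
    codeMeasure ν ((u : Set ℕ).pi t) = ∏ i ∈ u, ν (t i) :=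
  Measure.infinitePi_pi _ fun _ _ => .of_discrete

/-- The event is a product set in the first `l + 1` coordinates. The set `t` will be the letters
whose subcylinders a ball can meet. -/
theorem codeMeasure_prefix (l : ℕ) (η : ℕ → ℕ) (t : Set ℕ) :
    codeMeasure ν {ω | (∀ i < l, ω i = η i) ∧ ω l ∈ t}
      = (∏ i ∈ Finset.range l, ν {η i}) * ν t := by
  have h1 : {ω : ℕ → ℕ | (∀ i < l, ω i = η i) ∧ ω l ∈ t}
      = ((Finset.range (l + 1) : Finset ℕ) : Set ℕ).pi fun i => if i < l then {η i} else t := by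
    ext ω
    simp only [mem_ofPred_eq, Set.mem_pi, Finset.coe_range, mem_Iio]
    constructor
    · rintro ⟨h1, h2⟩ i hi
      split_ifs with hil
      · exact h1 i hil
      · rwa [show i = l by omega]
    · intro h1
      refine ⟨fun i hi => ?_, ?_⟩
      · simpa [hi] using h1 i (by omega)
      · simpa using h1 l (by omega)
  rw [h1, codeMeasure_pi, Finset.prod_range_succ]
  simp only [lt_irrefl, if_false]
  congr 1
  exact Finset.prod_congr rfl fun i hi => by rw [if_pos (Finset.mem_range.1 hi)]

theorem ae_forall_mem_of_measure_compl_eq_zero {t : Set ℕ} (ht : ν tᶜ = 0) :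
    ∀ᵐ ω ∂codeMeasure ν, ∀ i, ω i ∈ t := by
  refine ae_all_iff.2 fun i => ?_
  have h1 : {ω : ℕ → ℕ | ¬ ω i ∈ t} = (({i} : Finset ℕ) : Set ℕ).pi fun _ => tᶜ := by
    ext ω; simp
  rw [ae_iff, h1, codeMeasure_pi]
  simp [ht]

/-- Avoiding `k` on `M` consecutive coordinates has probability `ν {k}ᶜ ^ M`, which tends to `0`. -/
theorem ae_frequently_eq {k : ℕ} (hk : ν {k} ≠ 0) :
    ∀ᵐ ω ∂codeMeasure ν, ∀ N, ∃ i, N ≤ i ∧ ω i = k := by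
  refine ae_all_iff.2 fun N => ?_
  rw [ae_iff]
  have hlt : ν {k}ᶜ < 1 := by
    rw [prob_compl_eq_one_sub .of_discrete]
    exact ENNReal.sub_lt_self ENNReal.one_ne_top one_ne_zero hk
  refine le_antisymm (ge_of_tendsto' (ENNReal.tendsto_pow_atTop_nhds_zero_of_lt_one hlt)
    fun M => ?_) bot_le
  have h1 := codeMeasure_pi ν (Finset.Ico N (N + M)) fun _ => {k}ᶜ
  rw [Finset.prod_const, Nat.card_Ico, Nat.add_sub_cancel_left] at h1
  rw [← h1]
  refine measure_mono fun ω hω i hi => ?_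
  simp only [mem_ofPred_eq, not_exists, not_and] at hω
  exact hω i (Finset.mem_Ico.1 (Finset.mem_coe.1 hi)).1

end

theorem prod_ofReal_ratio_rpow (l : ℕ) (η : ℕ → ℕ) (s : ℝ) :
    ∏ i ∈ Finset.range l, ENNReal.ofReal (ratio (η i) ^ s)
      = ENNReal.ofReal (prefixRatio l η ^ s) := by
  rw [← ENNReal.ofReal_prod_of_nonneg fun i _ => Real.rpow_nonneg (ratio_pos _).le s,
    Real.finsetProd_rpow _ _ fun i _ => (ratio_pos _).le]
  rfl

theorem codeMeasure_letterMeasure_prefix {n : ℕ} {s : ℝ}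
    [IsProbabilityMeasure (letterMeasure n s)] {l : ℕ} {η : ℕ → ℕ} (hη : ∀ i < l, η i < n)
    (t : Set ℕ) :
    codeMeasure (letterMeasure n s) {ω | (∀ i < l, ω i = η i) ∧ ω l ∈ t}
      = ENNReal.ofReal (prefixRatio l η ^ s) * letterMeasure n s t := by
  rw [codeMeasure_prefix, ← prod_ofReal_ratio_rpow]
  congr 1
  exact Finset.prod_congr rfl fun i hi => letterMeasure_singleton (hη i (Finset.mem_range.1 hi)) s

/-- The self-similar measure on the limit set. -/
noncomputable abbrev limitMeasure (n : ℕ) (s : ℝ) [IsProbabilityMeasure (letterMeasure n s)] :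
    Measure ℝ :=
  (codeMeasure (letterMeasure n s)).map coding

/-! ### Masses of balls. -/

/-- A prefix whose ratio is comparable to `r`. -/
theorem exists_prefixRatio_between {n : ℕ} {l : ℕ} {η : ℕ → ℕ} (hη : ∀ i < l, η i < n)
    {r : ℝ} (hr0 : 0 < r) (hr1 : r ≤ 1) (hl : prefixRatio l η ≤ r) :
    ∃ j ≤ l, ratio (n - 1) * r ≤ prefixRatio j η ∧ prefixRatio j η ≤ r := by
  classical
  have hex : ∃ j, prefixRatio j η ≤ r := ⟨l, hl⟩
  have hjl := Nat.find_le (n := l) hl (h := hex)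
  refine ⟨Nat.find hex, hjl, ?_, Nat.find_spec hex⟩
  cases hj : Nat.find hex with
  | zero =>
    have h1 : ratio (n - 1) * r ≤ 1 := by
      have := ratio_le_half (n - 1)
      have := ratio_pos (n - 1)
      nlinarith
    simpa [prefixRatio] using h1
  | succ j =>
    have h1 : r < prefixRatio j η := not_le.1 (Nat.find_min hex (by omega))
    have h2 : ratio (n - 1) ≤ ratio (η j) := ratio_anti (by have := hη j (by omega); omega)
    have h3 : prefixRatio (j + 1) η = prefixRatio j η * ratio (η j) := Finset.prod_range_succ _ _
    rw [h3, mul_comm]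
    exact mul_le_mul h1.le h2 (ratio_pos _).le (prefixRatio_pos _ _).le

/-- The ball contains a whole cylinder through `x` whose length is between `ratio (n - 1) * r` and
`r`. -/
theorem le_limitMeasure_closedBall {n : ℕ} {s : ℝ} (hs0 : 0 ≤ s)
    [IsProbabilityMeasure (letterMeasure n s)] {x : ℝ} (hx : x ∈ J n) {r : ℝ} (hr0 : 0 < r)
    (hr1 : r ≤ 1) :
    ENNReal.ofReal ((ratio (n - 1) * r) ^ s) ≤ limitMeasure n s (Metric.closedBall x r) := by
  obtain ⟨l, hl⟩ := exists_pow_lt_of_lt_one hr0 (by norm_num : (1 / 2 : ℝ) < 1)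
  obtain ⟨η, hη, z, hz, rfl⟩ := exists_prefixMap_of_mem_J hx (Nat.le_add_left 1 l)
  have hlr : prefixRatio (l + 1) η ≤ r := by
    refine (prefixRatio_le _ _).trans (le_trans ?_ hl.le)
    exact pow_le_pow_of_le_one (by norm_num) (by norm_num) (Nat.le_succ l)
  obtain ⟨j, hjl, hj1, hj2⟩ := exists_prefixRatio_between hη hr0 hr1 hlr
  obtain ⟨m, hm⟩ := Nat.exists_eq_add_of_le hjl
  rw [hm, prefixMap_add]
  have hw := prefixMap_mem_Icc m (fun i => η (i + j)) hz
  set w := prefixMap m (fun i => η (i + j)) z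
  calc ENNReal.ofReal ((ratio (n - 1) * r) ^ s) ≤ ENNReal.ofReal (prefixRatio j η ^ s) := by
        refine ENNReal.ofReal_le_ofReal (Real.rpow_le_rpow ?_ hj1 hs0)
        exact mul_nonneg (ratio_pos _).le hr0.le
    _ = codeMeasure (letterMeasure n s) {ω | (∀ i < j, ω i = η i) ∧ ω j ∈ univ} := by
        rw [codeMeasure_letterMeasure_prefix fun i hi => hη i (by omega)]; simp
    _ ≤ limitMeasure n s (Metric.closedBall (prefixMap j η w) r) := by
        rw [Measure.map_apply measurable_coding Metric.isClosed_closedBall.measurableSet]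
        refine measure_mono fun ω hω => ?_
        have h1 : prefixMap j ω = prefixMap j η := by
          have h2 : (List.range j).map (fun i => ω i + 1) = (List.range j).map fun i => η i + 1 :=
            List.map_congr_left fun i hi => by rw [hω.1 i (List.mem_range.1 hi)]
          rw [← wordMap_map_range, h2, wordMap_map_range]
        have h3 := coding_mem_Icc fun i => ω (i + j)
        rw [mem_preimage, Metric.mem_closedBall, Real.dist_eq, coding_eq_prefixMap j, h1,
          abs_prefixMap_sub]
        refine (mul_le_of_le_one_right (prefixRatio_pos _ _).le ?_).trans hj2
        rw [abs_le]
        constructor <;> linarith [h3.1, h3.2, hw.1, hw.2]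

/-- A ball around a point of the last first-level cylinder of a cylinder meets few cylinders of
the next level. -/
theorem limitMeasure_closedBall_le {n : ℕ} (hn : 2 ≤ n) {s : ℝ}
    [IsProbabilityMeasure (letterMeasure n s)] {ω : ℕ → ℕ} {l : ℕ} (hω : ∀ i, ω i < n)
    (hl : ω l = n - 1) :
    limitMeasure n s (Metric.closedBall (coding ω) (prefixRatio l ω * (1 / (n + 1))))
      ≤ ENNReal.ofReal (prefixRatio l ω ^ s) * letterMeasure n s {k | n ≤ 2 * k + 4} := by
  rw [Measure.map_apply measurable_coding Metric.isClosed_closedBall.measurableSet,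
    ← codeMeasure_letterMeasure_prefix fun i _ => hω i]
  refine measure_mono fun η hη => ?_
  have hL := prefixRatio_pos l ω
  have hn2 : (2 : ℝ) ≤ n := by exact_mod_cast hn
  rw [mem_preimage, Metric.mem_closedBall, Real.dist_eq, coding_eq_prefixMap l ω] at hη
  have hy := coding_mem_first fun i => ω (i + l)
  simp only [zero_add, hl] at hy
  rw [Nat.cast_sub (by omega : 1 ≤ n), Nat.cast_one, sub_add_cancel,
    show (n : ℝ) - 1 + 2 = n + 1 by ring] at hy
  set y := coding fun i => ω (i + l)
  -- `z` is the preimage of `coding η` under the affine map `prefixMap l ω`, whose slope has sign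
  -- `(-1) ^ l`.
  set z := y + (-1) ^ l * (coding η - prefixMap l ω y) / prefixRatio l ω with hz
  have hzy : |z - y| ≤ 1 / (n + 1) := by
    rw [hz, add_sub_cancel_left, abs_div, abs_mul, abs_pow, abs_neg, abs_one, one_pow, one_mul,
      abs_of_pos hL, div_le_iff₀ hL, mul_comm]
    exact hη
  have hηz : coding η = prefixMap l ω z := by
    have h1 := prefixMap_sub l ω z y
    have h2 : z - y = (-1) ^ l * (coding η - prefixMap l ω y) / prefixRatio l ω := by
      rw [hz, add_sub_cancel_left]
    have h3 : ((-1 : ℝ) ^ l) * (-1) ^ l = 1 := by rw [← mul_pow]; norm_num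
    rw [h2] at h1
    have h4 : (-1 : ℝ) ^ l * prefixRatio l ω *
        ((-1) ^ l * (coding η - prefixMap l ω y) / prefixRatio l ω)
        = ((-1 : ℝ) ^ l * (-1) ^ l) * (coding η - prefixMap l ω y) := by field_simp
    rw [h4, h3] at h1
    linarith
  have hn1 : 1 / ((n : ℝ) + 1) ≤ 1 / n := one_div_le_one_div_of_le (by linarith) (by linarith)
  have hnhalf : 1 / (n : ℝ) ≤ 1 / 2 := one_div_le_one_div_of_le (by norm_num) hn2
  have hnpos : (0 : ℝ) < 1 / (n + 1) := by positivity
  -- The radius `1/(n+1)` is at most the distance from `y` to `0`, so the ball does not leak out of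
  -- the current cylinder for codes.
  have hzI : z ∈ Icc (0 : ℝ) 1 := by
    have := abs_le.1 hzy
    constructor <;> linarith [hy.1, hy.2]
  have hpre := eq_of_coding_eq_prefixMap l η ω hzI hηz
  refine ⟨hpre, ?_⟩
  have h1 : prefixMap l η = prefixMap l ω := by
    have h2 : (List.range l).map (fun i => η i + 1) = (List.range l).map fun i => ω i + 1 :=
      List.map_congr_left fun i hi => by rw [hpre i (List.mem_range.1 hi)]
    rw [← wordMap_map_range, h2, wordMap_map_range]
  rw [coding_eq_prefixMap l η, h1] at hηz
  have hz' := prefixMap_injective l ω hηz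
  have h3 := (coding_mem_first fun i => η (i + l)).1
  rw [hz', zero_add] at h3
  have h4 : 1 / ((η l : ℝ) + 2) ≤ 2 / n := by
    have h5 : z ≤ 1 / n + 1 / n := by linarith [(abs_le.1 hzy).2, hy.2]
    calc _ ≤ _ := h3
      _ ≤ _ := h5
      _ = 2 / n := by ring
  rw [div_le_div_iff₀ (by positivity) (by linarith)] at h4
  have h6 : n ≤ 2 * (η l + 2) := by
    have : (n : ℝ) ≤ 2 * (η l + 2) := by linarith
    exact_mod_cast this
  simp only [mem_ofPred_eq]
  omega

/-! ### Bounds for the dimension and the packing measure. -/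

theorem h_le {n : ℕ} {s : ℝ} (hs0 : 0 ≤ s) (hs : ∑ k ∈ Finset.range n, ratio k ^ s = 1) :
    h n ≤ s := by
  have := isProbabilityMeasure_letterMeasure hs
  have : IsProbabilityMeasure (limitMeasure n s) :=
    Measure.isProbabilityMeasure_map measurable_coding.aemeasurable
  refine le_of_forall_gt_imp_ge_of_dense fun t hst => csInf_le ⟨0, fun _ hx => hx.1⟩ ⟨by linarith, ?_⟩
  have hρ : 0 < ratio (n - 1) / 2 := half_pos (ratio_pos _)
  refine packingMeasure_eq_zero (limitMeasure n s) (c := ENNReal.ofReal ((ratio (n - 1) / 2) ^ s))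
    ?_ ENNReal.ofReal_ne_top hst one_pos fun x hx r hr0 hr1 => ?_
  · simpa using Real.rpow_pos_of_pos hρ s
  · refine le_trans (le_of_eq ?_) (le_limitMeasure_closedBall hs0 hx hr0 hr1)
    rw [ENNReal.ofReal_rpow_of_pos (by linarith), ← ENNReal.ofReal_mul (by positivity),
      ← Real.mul_rpow hρ.le (by linarith)]
    congr 2
    ring

theorem one_le_mul_packingMeasure {n : ℕ} (hn : 2 ≤ n) {s K : ℝ}
    (hs : ∑ k ∈ Finset.range n, ratio k ^ s = 1) (hK : 0 < K)
    (hKs : letterMeasure n s {k | n ≤ 2 * k + 4} ≤ ENNReal.ofReal (K * (2 / (n + 1)) ^ s)) :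
    1 ≤ ENNReal.ofReal K * packingMeasure s (J n) := by
  classical
  have := isProbabilityMeasure_letterMeasure hs
  have : IsProbabilityMeasure (limitMeasure n s) :=
    Measure.isProbabilityMeasure_map measurable_coding.aemeasurable
  set S : Set (ℕ → ℕ) := {ω | (∀ i, ω i < n) ∧ ∀ N, ∃ i, N ≤ i ∧ ω i = n - 1} with hS
  have hS1 : codeMeasure (letterMeasure n s) S = 1 := by
    have hlt := ae_forall_mem_of_measure_compl_eq_zero (letterMeasure n s) (t := Iio n) (by
      rw [letterMeasure_apply]
      exact Finset.sum_eq_zero fun k hk => by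
        simp only [Finset.mem_filter, Finset.mem_range, mem_compl_iff, mem_Iio] at hk
        omega)
    have hfreq := ae_frequently_eq (letterMeasure n s) (k := n - 1) (by
      rw [letterMeasure_singleton (by omega)]
      simpa using Real.rpow_pos_of_pos (ratio_pos _) s)
    rw [← measure_univ (μ := codeMeasure (letterMeasure n s))]
    refine measure_congr (eventuallyEq_univ.2 ?_)
    filter_upwards [hlt, hfreq] with ω h1 h2 using ⟨h1, h2⟩
  have hmeas : 1 ≤ limitMeasure n s (coding '' S) := by
    -- This inequality holds for arbitrary sets, so the image of `S` need not be shown measurable.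
    refine le_trans ?_ (Measure.le_map_apply measurable_coding.aemeasurable _)
    rw [← hS1]
    exact measure_mono (subset_preimage_image _ _)
  refine hmeas.trans (measure_le_packingMeasure _ (by simpa using hK) ENNReal.ofReal_ne_top ?_ ?_)
  · rintro _ ⟨ω, hω, rfl⟩
    exact coding_mem_J hω.1
  · rintro _ ⟨ω, hω, rfl⟩ δ hδ
    obtain ⟨N, hN⟩ := exists_pow_lt_of_lt_one hδ (by norm_num : (1 / 2 : ℝ) < 1)
    obtain ⟨l, hNl, hl⟩ := hω.2 N
    have hL := prefixRatio_pos l ω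
    refine ⟨prefixRatio l ω * (1 / (n + 1)), by positivity, ?_,
      (limitMeasure_closedBall_le hn hω.1 hl).trans ?_⟩
    · calc prefixRatio l ω * (1 / (n + 1)) ≤ prefixRatio l ω := by
            refine mul_le_of_le_one_right hL.le ?_
            rw [div_le_one (by positivity)]
            linarith [(Nat.cast_nonneg n : (0 : ℝ) ≤ n)]
        _ ≤ (1 / 2) ^ l := prefixRatio_le l ω
        _ ≤ (1 / 2) ^ N := pow_le_pow_of_le_one (by norm_num) (by norm_num) hNl
        _ < δ := hN
    · refine (mul_le_mul_right hKs _).trans (le_of_eq ?_)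
      rw [ENNReal.ofReal_rpow_of_pos (by positivity), ← ENNReal.ofReal_mul (by positivity),
        ← ENNReal.ofReal_mul hK.le,
        show 2 * (prefixRatio l ω * (1 / ((n : ℝ) + 1))) = prefixRatio l ω * (2 / (n + 1)) by ring,
        Real.mul_rpow hL.le (by positivity)]
      congr 1
      ring

/-! ### Asymptotics of the exponent and of the tail mass. -/

theorem sum_range_ratio (n : ℕ) : ∑ k ∈ Finset.range n, ratio k = 1 - 1 / (n + 1) := by
  induction n with
  | zero => simp
  | succ n ih =>
    rw [Finset.sum_range_succ, ih, ratio_eq_sub]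
    push_cast
    ring

theorem exists_sum_ratio_rpow_eq_one {n : ℕ} (hn : 1 ≤ n) :
    ∃ s ∈ Icc (0 : ℝ) 1, ∑ k ∈ Finset.range n, ratio k ^ s = 1 := by
  have hcont : ContinuousOn (fun s : ℝ => ∑ k ∈ Finset.range n, ratio k ^ s) (Icc 0 1) :=
    (continuous_finsetSum _ fun k _ => Real.continuous_const_rpow (ratio_pos k).ne').continuousOn
  refine intermediate_value_Icc' zero_le_one hcont ⟨?_, ?_⟩
  · simp only [Real.rpow_one, sum_range_ratio]
    have : (0 : ℝ) < 1 / (n + 1) := by positivity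
    linarith
  · simpa using hn

/-- The nonnegative differences `ratio k ^ s - ratio k` add up to `1/(n+1)`. The first alone is at
least `(log 2 / 2) * (1 - s)`, hence at least `(1 - s) / 4`. -/
theorem one_sub_le_of_sum_ratio_rpow {n : ℕ} (hn : 1 ≤ n) {s : ℝ} (hs1 : s ≤ 1)
    (hs : ∑ k ∈ Finset.range n, ratio k ^ s = 1) : 1 - s ≤ 4 / (n + 1) := by
  have h1 : ∑ k ∈ Finset.range n, (ratio k ^ s - ratio k) = 1 / (n + 1) := by
    rw [Finset.sum_sub_distrib, hs, sum_range_ratio]; ring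
  have h2 : ratio 0 ^ s - ratio 0 ≤ 1 / (n + 1) := by
    rw [← h1]
    refine Finset.single_le_sum (f := fun k => ratio k ^ s - ratio k) (fun k _ => ?_)
      (Finset.mem_range.2 hn)
    have h3 := Real.rpow_le_rpow_of_exponent_ge (ratio_pos k)
      ((ratio_le_half k).trans (by norm_num)) hs1
    rw [Real.rpow_one] at h3
    linarith
  have h4 : ratio 0 = 1 / 2 := by norm_num [ratio]
  have h5 : (1 / 2 : ℝ) ^ s = 1 / 2 * Real.exp (Real.log 2 * (1 - s)) := by
    have h6 : (1 / 2 : ℝ) = Real.exp (-Real.log 2) := by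
      rw [Real.exp_neg, Real.exp_log two_pos, one_div]
    rw [h6, ← Real.exp_mul, ← Real.exp_add]
    congr 1
    ring
  have h7 := Real.add_one_le_exp (Real.log 2 * (1 - s))
  have h8 := Real.log_two_gt_d9
  have h9 : 1 / 2 * (1 - s) ≤ Real.log 2 * (1 - s) :=
    mul_le_mul_of_nonneg_right (by linarith) (by linarith)
  rw [h4, h5] at h2
  have h10 : (4 : ℝ) / (n + 1) = 4 * (1 / (n + 1)) := by ring
  rw [h10]
  linarith

/-- Each weight is `ratio k` times `(1 / ratio k) ^ (1 - s)`. With `1 / ratio k ≤ (n+1) ^ 2` and `1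
- s ≤ 4/(n+1)`, the correction is at most `(n+1) ^ (8/(n+1))`; the sum of the ratios telescopes. -/
theorem letterMeasure_tail_le {n : ℕ} (hn : 4 ≤ n) {s : ℝ} (hs1 : s ≤ 1)
    (hs : ∑ k ∈ Finset.range n, ratio k ^ s = 1) :
    letterMeasure n s {k | n ≤ 2 * k + 4} ≤ ENNReal.ofReal
      ((((n : ℝ) + 1) ^ (1 / ((n : ℝ) + 1))) ^ 8 * (2 / (n - 2) - 1 / (n + 1))) := by
  classical
  have hn4 : (4 : ℝ) ≤ n := by exact_mod_cast hn
  have hx : (1 : ℝ) ≤ n + 1 := by linarith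
  set B := (((n : ℝ) + 1) ^ (1 / ((n : ℝ) + 1))) ^ 8 with hB
  have hB0 : 0 ≤ B := by positivity
  rw [letterMeasure_apply,
    ← ENNReal.ofReal_sum_of_nonneg fun k _ => Real.rpow_nonneg (ratio_pos k).le s]
  refine ENNReal.ofReal_le_ofReal ?_
  have hterm : ∀ k < n, ratio k ^ s ≤ B * ratio k := by
    intro k hk
    have hkn : (k : ℝ) + 1 ≤ n := by exact_mod_cast hk
    have h1 : ratio k ^ s = (((k : ℝ) + 1) * (k + 2)) ^ (1 - s) * ratio k := by
      have h2 : ((k : ℝ) + 1) * (k + 2) = (ratio k)⁻¹ := by unfold ratio; rw [one_div, inv_inv]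
      have h3 := ratio_pos k
      rw [h2, Real.inv_rpow h3.le, ← Real.rpow_neg h3.le]
      nth_rewrite 3 [← Real.rpow_one (ratio k)]
      rw [← Real.rpow_add h3]
      congr 1
      ring
    rw [h1]
    refine mul_le_mul_of_nonneg_right ?_ (ratio_pos k).le
    calc (((k : ℝ) + 1) * (k + 2)) ^ (1 - s) ≤ (((n : ℝ) + 1) ^ (2 : ℝ)) ^ (1 - s) := by
          refine Real.rpow_le_rpow (by positivity) ?_ (by linarith)
          rw [Real.rpow_two]
          nlinarith [(Nat.cast_nonneg k : (0 : ℝ) ≤ k)]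
      _ ≤ (((n : ℝ) + 1) ^ (2 : ℝ)) ^ (4 / ((n : ℝ) + 1)) :=
          Real.rpow_le_rpow_of_exponent_le (Real.one_le_rpow hx (by norm_num))
            (one_sub_le_of_sum_ratio_rpow (by omega) hs1 hs)
      _ = B := by
          rw [hB, ← Real.rpow_mul (by linarith), ← Real.rpow_natCast, ← Real.rpow_mul (by linarith)]
          congr 1
          push_cast
          ring
  have han : (n - 3) / 2 ≤ n := by omega
  refine (Finset.sum_le_sum fun k hk =>
    hterm k (Finset.mem_range.1 (Finset.mem_filter.1 hk).1)).trans ?_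
  -- The truncated quotient `(n - 3) / 2` is the least `k` with `n ≤ 2 * k + 4`.
  refine (Finset.sum_le_sum_of_subset_of_nonneg (t := Finset.Ico ((n - 3) / 2) n) (fun k hk => ?_)
    fun k _ _ => mul_nonneg hB0 (ratio_pos k).le).trans ?_
  · simp only [Finset.mem_filter, Finset.mem_range, mem_ofPred_eq] at hk
    rw [Finset.mem_Ico]
    omega
  · rw [← Finset.mul_sum, Finset.sum_Ico_eq_sub _ han, sum_range_ratio, sum_range_ratio]
    refine mul_le_mul_of_nonneg_left ?_ hB0
    have h1 : 1 / ((((n - 3) / 2 : ℕ) : ℝ) + 1) ≤ 2 / (n - 2) := by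
      rw [div_le_div_iff₀ (by positivity) (by linarith)]
      have h2 : n ≤ 2 * ((n - 3) / 2) + 4 := by omega
      have h3 : (n : ℝ) ≤ 2 * (((n - 3) / 2 : ℕ) : ℝ) + 4 := by exact_mod_cast h2
      linarith
    linarith

/-- The upper bound for the ratio of the mass of suitable balls to the power of their diameter. -/
noncomputable def densityBound (n : ℕ) : ℝ :=
  (((n : ℝ) + 1) ^ (1 / ((n : ℝ) + 1))) ^ 8 * (1 / 2 + 3 / (n - 2))

theorem densityBound_pos {n : ℕ} (hn : 4 ≤ n) : 0 < densityBound n := by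
  have hn4 : (4 : ℝ) ≤ n := by exact_mod_cast hn
  have h1 : 0 < 3 / ((n : ℝ) - 2) := div_pos three_pos (by linarith)
  unfold densityBound
  positivity

theorem tendsto_densityBound : Tendsto densityBound atTop (𝓝 (1 / 2)) := by
  have h0 : Tendsto (fun n : ℕ => (n : ℝ) + 1) atTop atTop :=
    tendsto_atTop_add_const_right _ _ tendsto_natCast_atTop_atTop
  have h1 : Tendsto (fun n : ℕ => (((n : ℝ) + 1) ^ (1 / ((n : ℝ) + 1))) ^ 8) atTop (𝓝 (1 ^ 8)) :=
    (tendsto_rpow_div.comp h0).pow 8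
  have h2 : Tendsto (fun n : ℕ => 3 / ((n : ℝ) - 2)) atTop (𝓝 0) :=
    (tendsto_atTop_add_const_right _ (-2) tendsto_natCast_atTop_atTop).const_div_atTop 3
  have h3 := h1.mul (h2.const_add (1 / 2))
  rw [one_pow, one_mul, add_zero] at h3
  exact h3

theorem inv_densityBound_le_packingMeasure {n : ℕ} (hn : 4 ≤ n) :
    ENNReal.ofReal (densityBound n)⁻¹ ≤ packingMeasure (h n) (J n) := by
  obtain ⟨s, ⟨hs0, hs1⟩, hs⟩ := exists_sum_ratio_rpow_eq_one (by omega : 1 ≤ n)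
  have hn4 : (4 : ℝ) ≤ n := by exact_mod_cast hn
  have hK := densityBound_pos hn
  have h1 := one_le_mul_packingMeasure (by omega) hs hK
    ((letterMeasure_tail_le hn hs1 hs).trans (ENNReal.ofReal_le_ofReal ?_))
  · refine le_trans ?_ (packingMeasure_anti (J n) (h_le hs0 hs))
    rw [ENNReal.ofReal_inv_of_pos hK, ← one_div]
    exact ENNReal.div_le_of_le_mul' h1
  -- The base is at most `1` and `s ≤ 1`, so the `s`-th power of the diameter may be replaced by the
  -- diameter itself.
  · have h2 : 2 / ((n : ℝ) + 1) ≤ (2 / ((n : ℝ) + 1)) ^ s := by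
      have h3 := Real.rpow_le_rpow_of_exponent_ge (by positivity : 0 < 2 / ((n : ℝ) + 1))
        (by rw [div_le_one (by positivity)]; linarith) hs1
      rwa [Real.rpow_one] at h3
    refine le_trans (le_of_eq ?_) (mul_le_mul_of_nonneg_left h2 hK.le)
    have h4 : (n : ℝ) - 2 ≠ 0 := by linarith
    have h5 : (n : ℝ) + 1 ≠ 0 := by linarith
    have h6 : 2 / ((n : ℝ) - 2) - 1 / (n + 1) = (1 / 2 + 3 / (n - 2)) * (2 / (n + 1)) := by
      field_simp
      ring
    rw [densityBound, h6, mul_assoc]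

end LinearGauss

theorem mainTheorem2 :
    2 ≤ Filter.liminf (fun n : ℕ => LinearGauss.packingMeasure (LinearGauss.h n) (LinearGauss.J n))
      Filter.atTop := by
  have h1 : Tendsto (fun n => ENNReal.ofReal (LinearGauss.densityBound n)⁻¹) atTop (nhds 2) := by
    have h2 := ENNReal.tendsto_ofReal
      (LinearGauss.tendsto_densityBound.inv₀ (by norm_num : (1 / 2 : ℝ) ≠ 0))
    simpa using h2
  rw [← h1.liminf_eq]
  refine liminf_le_liminf ?_
  filter_upwards [eventually_ge_atTop 4] with n hn
    using LinearGauss.inv_densityBound_le_packingMeasure hn
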